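/- An interval map is a continuous map $f:I\to I$ of an interval $I\subseteq\mathbb R$. Two real sequences $(a_n)_{n\ge0}$, $(b_n)_{n\ge0}$ have the same order pattern if $a_m<a_n\iff b_m<b_n$ for all $m,n$; the orbit pattern of $x\in I$ under $f$ is the order pattern of the sequence $(f^n(x))_{n\ge 0}$. Let $\mathcal{EF}$ be the class of interval maps for which every point is eventually fixed, and call an orbit pattern an $\mathcal{EF}$ orbit pattern if it is the orbit pattern of some point under some map in $\mathcal{EF}$. The tag of an $\mathcal{EF}$ orbit pattern, represented by $(f^n(x))_{n\ge0}$, is the word $c_0c_1\cdots c_{N-1}$ over $\{L,R\}$, where $N$ is the least index for which $f^N(x)$ is a fixed point, $c_i=L$ if $f^{i+1}(x)<f^i(x)$, and $c_i=R$ if $f^{i+1}(x)>f^i(x)$. An interval map $f:I\to I$ admits an orbit pattern if some $x\in I$ has that orbit pattern under $f$, and it admits the tag $w$ if it admits an $\mathcal{EF}$ orbit pattern with tag $w$. An $\mathcal{EF}$ orbit pattern (or a word) forces another if every interval map admitting the first (as an orbit pattern, respectively as a tag) also admits the second. A word $u$ is derivable from a word $w$ if it is obtained from $w$ by a finite number ($\ge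 0$) of applications of the rules, in any order, $$vRRv'\Rightarrow vRv',\quad vLLv'\Rightarrow vLv',\quad vLRv'\Rightarrow vv',\quad vRLv'\Rightarrow vv',\quad vv'\Rightarrow v',$$ where $v,v'$ are arbitrary words. The language $\mathcal L_w$ is defined recursively: if $|w|\le 2$, then $\mathcal L_w$ is the set of all tails (suffixes, including $w$ itself and the empty word) of $w$; if $|w|>2$, then $$\mathcal L_w=\begin{cases}\mathcal L_{Rw'}\cup\{Lu:u\in\mathcal L_{Rw'},\ u\text{ starts with }R\}&\text{if }w=LRw',\\ \mathcal L_{LLw'}\cup\{Lu:u\in\mathcal L_{LLw'},\ u\text{ starts with }L\}&\text{if }w=LLLw',\\ \mathcal L_{LRw'}\cup\{Lu:u\in\mathcal L_{LRw'}\}&\text{if }w=LLRw',\end{cases}$$ and dually, with $L$ and $R$ interchanged, if $w$ starts with $R$. Theorem. (1) The tag is a bijection from the set of $\mathcal{EF}$ orbit patterns onto the set $\{L,R\}^*$ of all words over $\{L,R\}$. (2) An $\mathcal{EF}$ orbit pattern $\alpha$ forces an $\mathcal{EF}$ orbit pattern $\beta$ if and only if the tag of $\beta$ is derivable from the tag of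 $\alpha$. (3) For all words $w,u$ over $\{L,R\}$ the following are equivalent: $w$ forces $u$; $u$ is derivable from $w$; $u\in\mathcal L_w$. In (2) and (3), the same holds when in the definition of forcing only the continuous self-maps of $[0,1]$ are considered. -/

import Mathlib

namespace EventuallyFixed

/-! ### Interval maps, trajectories and order patterns -/

/-- The trajectory `x, f x, f (f x), …` of a point under a self-map of a subset of the real line,
as a sequence of real numbers. -/
def trajectory {I : Set ℝ} (f : I → I) (x : I) : ℕ → ℝ := fun n => ((f^[n] x : I) : ℝ)

/-- `f` belongs to the class `EF`: every point is eventually fixed. -/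
def IsEF {I : Set ℝ} (f : I → I) : Prop := ∀ x : I, ∃ n : ℕ, f (f^[n] x) = f^[n] x

/-- Two real sequences have the same order pattern when `a m < a n ↔ b m < b n` for all `m, n`. -/
instance orderSetoid : Setoid (ℕ → ℝ) where
  r a b := ∀ m n : ℕ, a m < a n ↔ b m < b n
  iseqv :=
    { refl := fun _ _ _ => Iff.rfl
      symm := fun h m n => (h m n).symm
      trans := fun h k m n => (h m n).trans (k m n) }

/-- Order patterns of real sequences. -/
def OrderPattern : Type := Quotient orderSetoid

/-- The orbit pattern of the point `x`: the order pattern of its trajectory. -/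
def orbitPattern {I : Set ℝ} (f : I → I) (x : I) : OrderPattern :=
  Quotient.mk orderSetoid (trajectory f x)

/-- The `EF` orbit patterns: the orbit patterns of the points of interval maps in the class `EF`
(intervals are the order-connected subsets of the line). -/
def EFPattern : Type :=
  {p : OrderPattern // ∃ (I : Set ℝ) (f : I → I) (x : I),
    I.OrdConnected ∧ Continuous f ∧ IsEF f ∧ orbitPattern f x = p}

/-- The map `f` admits the `EF` orbit pattern `α`. -/
def Admits {I : Set ℝ} (f : I → I) (α : EFPattern) : Prop := ∃ x : I, orbitPattern f x = α.1

/-- `α` forces `β` among the continuous self-maps of the set `I`. -/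
def PatternForcesOn (I : Set ℝ) (α β : EFPattern) : Prop :=
  ∀ f : I → I, Continuous f → Admits f α → Admits f β

/-- `α` forces `β`: every continuous interval map that admits `α` admits `β`. -/
def PatternForces (α β : EFPattern) : Prop :=
  ∀ I : Set ℝ, I.OrdConnected → PatternForcesOn I α β

/-! ### Tags -/

/-- The two letters: `L` for a step to the left and `R` for a step to the right. -/
inductive Letter : Type
  | L : Letter
  | R : Letter

/-- Words over `{L, R}`. -/
abbrev Word : Type := List Letter

open Classical in
/-- The tag of a sequence: with `N` the first index such that `a (N + 1) = a N`, the word of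
length `N` whose `i`-th letter is `L` if `a (i + 1) < a i`, and `R` otherwise. -/
noncomputable def seqTag (a : ℕ → ℝ) : Word :=
  (List.range (sInf {n : ℕ | a (n + 1) = a n})).map
    (fun i => if a (i + 1) < a i then Letter.L else Letter.R)

theorem seqTag_congr (a b : ℕ → ℝ) (h : ∀ m n : ℕ, a m < a n ↔ b m < b n) :
    seqTag a = seqTag b := by
  have h1 : {n : ℕ | a (n + 1) = a n} = {n : ℕ | b (n + 1) = b n} := by
    ext n
    simp only [Set.mem_ofPred_eq, le_antisymm_iff, ← not_lt, h]
  unfold seqTag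
  simp only [h1, h]

/-- The tag of an order pattern. -/
noncomputable def patternTag (p : OrderPattern) : Word :=
  Quotient.lift seqTag (fun a b h => seqTag_congr a b h) p

/-- The tag of an `EF` orbit pattern. -/
noncomputable def EFPattern.tag (α : EFPattern) : Word := patternTag α.1

/-- The map `f` admits the tag `w`: it admits an `EF` orbit pattern whose tag is `w`. -/
def AdmitsTag {I : Set ℝ} (f : I → I) (w : Word) : Prop := ∃ α : EFPattern, α.tag = w ∧ Admits f α

/-- `w` forces `u` among the continuous self-maps of the set `I`. -/
def ForcesOn (I : Set ℝ) (w u : Word) : Prop :=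
  ∀ f : I → I, Continuous f → AdmitsTag f w → AdmitsTag f u

/-- `w` forces `u`: every continuous interval map that admits the tag `w` admits the tag `u`. -/
def Forces (w u : Word) : Prop := ∀ I : Set ℝ, I.OrdConnected → ForcesOn I w u

/-! ### Derived words and constructed words -/

open Letter

/-- One application of a rule of derivation. -/
inductive Step : Word → Word → Prop
  | redRR (v v' : Word) : Step (v ++ [R, R] ++ v') (v ++ [R] ++ v')
  | redLL (v v' : Word) : Step (v ++ [L, L] ++ v') (v ++ [L] ++ v')
  | redLR (v v' : Word) : Step (v ++ [L, R] ++ v') (v ++ v')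
  | redRL (v v' : Word) : Step (v ++ [R, L] ++ v') (v ++ v')
  | tail (v v' : Word) : Step (v ++ v') v'

/-- `u` is derivable from `w` by finitely many applications of the rules. -/
def Derivable (w u : Word) : Prop := Relation.ReflTransGen Step w u

/-- The recursively defined language of a word: the words constructed from it. -/
def lang : Word → Set Word
  | L :: R :: c :: w =>
      lang (R :: c :: w) ∪ (L :: ·) '' {v | v ∈ lang (R :: c :: w) ∧ v.head? = some R}
  | L :: L :: L :: w =>
      lang (L :: L :: w) ∪ (L :: ·) '' {v | v ∈ lang (L :: L :: w) ∧ v.head? = some L}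
  | L :: L :: R :: w =>
      lang (L :: R :: w) ∪ (L :: ·) '' lang (L :: R :: w)
  | R :: L :: c :: w =>
      lang (L :: c :: w) ∪ (R :: ·) '' {v | v ∈ lang (L :: c :: w) ∧ v.head? = some L}
  | R :: R :: R :: w =>
      lang (R :: R :: w) ∪ (R :: ·) '' {v | v ∈ lang (R :: R :: w) ∧ v.head? = some R}
  | R :: R :: L :: w =>
      lang (R :: L :: w) ∪ (R :: ·) '' lang (R :: L :: w)
  | [a, b] => {v | v <:+ [a, b]}
  | [a] => {v | v <:+ [a]}
  | [] => {v | v <:+ []}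

end EventuallyFixed

/-! The proof rests on `PatTag`: each letter of the word tells on which side of the current term all
later terms lie, not only the next one. Such a word determines the order of all terms
(`PatTag.lt_iff_lt`), so tags are injective as soon as every orbit of an `EF` map satisfies `PatTag`
for its tag (`StepTag.patTag`). If it did not, a non-fixed point `x` would lie in the hull of the
orbit of its image, between two later terms. The two intervals cut off by `x` then cover each other
under an iterate of `f`, and a point that alternates between them forever cannot be eventually fixed
(`not_mem_hull_of_eventually_fixed`).

Forcing follows a cycle. Derivable words are forced because each rule can be carried out on orbits.
The gap between a term and all later ones is mapped over the next gap, so a modified end of an orbit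
that starts inside a gap can be pulled back to the beginning (`GapPoint.exists_cons`).

Forced words lie in `lang w` because some map in `EF` admits `w` and only words of `lang w`. This
`Model` is built letter by letter: the interval is lengthened at one end by a linear piece whose new
endpoint is sent to the previous starting point. The recursion defining `lang` lists the words that
the new points may follow (`Model.cons_L`). These maps also show that every word is a tag.

Words of `lang w` are derivable by a combinatorial induction (`exists_suffix_reds_of_mem_lang`). -/

namespace EventuallyFixed

open Letter Set

/-! ### Derivation of the constructed words -/

/-- One application of a rule of derivation other than the passage to a tail. -/
inductive Red : Word → Word → Prop
  | merge (c : Letter) (v v' : Word) : Red (v ++ c :: c :: v') (v ++ c :: v')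
  | cancel (c d : Letter) (h : c ≠ d) (v v' : Word) : Red (v ++ c :: d :: v') (v ++ v')

/-- Derivability without passing to tails. -/
abbrev Reds : Word → Word → Prop := Relation.ReflTransGen Red

theorem Red.step {w u : Word} (h : Red w u) : Step w u := by
  cases h with
  | merge c v v' =>
    cases c
    · simpa using Step.redLL v v'
    · simpa using Step.redRR v v'
  | cancel c d h v v' =>
    cases c <;> cases d
    · exact absurd rfl h
    · simpa using Step.redLR v v'
    · simpa using Step.redRL v v'
    · exact absurd rfl h

theorem Reds.append_left {w u : Word} (p : Word) (h : Reds w u) : Reds (p ++ w) (p ++ u) := by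
  refine Relation.ReflTransGen.lift (p ++ ·) ?_ _ _ h
  intro a b hab
  cases hab with
  | merge c v v' => simpa using Red.merge c (p ++ v) v'
  | cancel c d h v v' => simpa using Red.cancel c d h (p ++ v) v'

theorem Reds.append_right {w u : Word} (p : Word) (h : Reds w u) : Reds (w ++ p) (u ++ p) := by
  refine Relation.ReflTransGen.lift (· ++ p) ?_ _ _ h
  intro a b hab
  cases hab with
  | merge c v v' => simpa [Function.onFun] using Red.merge c v (v' ++ p)
  | cancel c d h v v' => simpa [Function.onFun] using Red.cancel c d h v (v' ++ p)

theorem Reds.cons {w u : Word} (c : Letter) (h : Reds w u) : Reds (c :: w) (c :: u) :=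
  h.append_left [c]

theorem Reds.merge (c : Letter) (w : Word) : Reds (c :: c :: w) (c :: w) :=
  .single (Red.merge c [] w)

theorem Reds.cancel {c d : Letter} (h : c ≠ d) (w : Word) : Reds (c :: d :: w) w :=
  .single (Red.cancel c d h [] w)

theorem Letter.eq_of_ne_of_ne {a b c : Letter} (h : a ≠ b) (h' : c ≠ b) : a = c := by
  cases a <;> cases b <;> cases c <;> simp_all

/-- A word of length at least two that starts and ends with the same letter reduces to that
letter. -/
theorem Reds.of_ends (c : Letter) : ∀ v : Word, Reds (c :: (v ++ [c])) [c]
  | [] => Reds.merge c []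
  | d :: v => by
    by_cases hd : d = c
    · subst hd
      exact (Reds.merge d _).trans (Reds.of_ends d v)
    · match v with
      | [] => exact Reds.cancel (Ne.symm hd) [c]
      | e :: v' =>
        by_cases he : e = c
        · subst he
          exact (Reds.cancel (Ne.symm hd) _).trans (Reds.of_ends e v')
        · obtain rfl := Letter.eq_of_ne_of_ne hd he
          exact ((Reds.merge d _).cons c).trans (Reds.of_ends c (d :: v'))
termination_by v => v.length

theorem Reds.of_ends_append (c : Letter) (v u : Word) : Reds (c :: (v ++ c :: u)) (c :: u) := by
  simpa using (Reds.of_ends c v).append_right u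

/-- The six recursive clauses share this form: a new word must continue with `b`, except after a
double letter followed by the other one, where every continuation is allowed. -/
theorem mem_lang_cons_iff (a b c : Letter) (w v : Word) :
    v ∈ lang (a :: b :: c :: w) ↔ v ∈ lang (b :: c :: w) ∨
      ∃ u ∈ lang (b :: c :: w), (u.head? = some b ∨ (a = b ∧ c ≠ b)) ∧ v = a :: u := by
  cases a <;> cases b <;> cases c <;>
    simp [lang, eq_comm, and_assoc]

theorem mem_lang_pair (a b : Letter) (v : Word) : v ∈ lang [a, b] ↔ v <:+ [a, b] := by
  cases a <;> cases b <;> simp [lang]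

theorem mem_lang_singleton (a : Letter) (v : Word) : v ∈ lang [a] ↔ v <:+ [a] := by
  cases a <;> simp [lang]

theorem mem_lang_nil (v : Word) : v ∈ lang [] ↔ v = [] := by
  simp [lang]

theorem mem_lang_cons_of_mem (a : Letter) {w v : Word} (h : v ∈ lang w) : v ∈ lang (a :: w) := by
  match w with
  | [] => rw [mem_lang_nil] at h; simp [mem_lang_singleton, h]
  | [b] =>
    rw [mem_lang_singleton] at h
    exact (mem_lang_pair a b v).2 (h.trans (List.suffix_cons a [b]))
  | b :: c :: w => exact (mem_lang_cons_iff a b c w v).2 (.inl h)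

theorem reds_cons_of_head {a b : Letter} {v s u : Word} (h : Reds s (b :: u)) :
    Reds (a :: (b :: v ++ s)) (a :: b :: u) :=
  Reds.cons a ((h.append_left (b :: v)).trans (Reds.of_ends_append b v u))

/-- The last letter decides. If it is `a`, the ends of the word agree; otherwise everything after
the double letter shrinks to one `c`, which cancels one `a`. -/
theorem reds_double (a c : Letter) (h : c ≠ a) (w : Word) : Reds (a :: a :: c :: w) [a] := by
  obtain ⟨l, e, hl⟩ : ∃ l e, c :: w = l ++ [e] :=
    ⟨_, _, (List.dropLast_append_getLast (List.cons_ne_nil c w)).symm⟩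
  rw [hl]
  by_cases he : e = a
  · subst he
    exact Reds.of_ends e (e :: l)
  · obtain rfl := Letter.eq_of_ne_of_ne h he
    have hc : Reds (l ++ [c]) [c] := by
      cases l with
      | nil => exact .refl
      | cons d l =>
        obtain ⟨rfl, -⟩ := List.cons_eq_cons.1 hl
        exact Reds.of_ends c l
    exact ((hc.append_left [a, a])).trans ((Reds.cancel (Ne.symm h) []).cons a)

/-- A single passage to a tail, made at the start, suffices. When `a` is put in front of `u'`, the
letters dropped to obtain `u'` must be absorbed by reductions instead. -/
theorem exists_suffix_reds_of_mem_lang :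
    ∀ (w : Word) {u : Word}, u ∈ lang w → ∃ v s, w = v ++ s ∧ Reds s u
  | [], u, h => ⟨[], [], rfl, by rw [(mem_lang_nil u).1 h]⟩
  | [a], u, h => by
    obtain ⟨v, hv⟩ := (mem_lang_singleton a u).1 h
    exact ⟨v, u, hv.symm, .refl⟩
  | [a, b], u, h => by
    obtain ⟨v, hv⟩ := (mem_lang_pair a b u).1 h
    exact ⟨v, u, hv.symm, .refl⟩
  | a :: b :: c :: w, u, h => by
    rcases (mem_lang_cons_iff a b c w u).1 h with h | ⟨u', h', hu, rfl⟩
    · obtain ⟨v, s, hs, hr⟩ := exists_suffix_reds_of_mem_lang (b :: c :: w) h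
      exact ⟨a :: v, s, by rw [hs]; rfl, hr⟩
    · refine ⟨[], _, rfl, ?_⟩
      obtain ⟨v, s, hs, hr⟩ := exists_suffix_reds_of_mem_lang (b :: c :: w) h'
      cases v with
      | nil =>
        rw [hs]
        exact Reds.cons a hr
      | cons b' v =>
        obtain ⟨rfl, hs'⟩ := List.cons_eq_cons.1 hs
        cases u' with
        | nil =>
          rcases hu with hu | ⟨rfl, hc⟩
          · simp at hu
          · exact reds_double a c hc w
        | cons d u =>
          by_cases hd : d = b
          · subst hd
            rw [hs]
            exact reds_cons_of_head hr
          · rcases hu with hu | ⟨rfl, hc⟩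
            · simp [hd] at hu
            · obtain rfl := Letter.eq_of_ne_of_ne hd hc
              have : Reds (d :: w) (d :: u) := by
                cases v with
                | nil => rw [show d :: w = s from hs']; exact hr
                | cons d' v =>
                  obtain ⟨rfl, hs'⟩ := List.cons_eq_cons.1 hs'
                  rw [hs']
                  exact (hr.append_left (d :: v)).trans (Reds.of_ends_append d v u)
              exact (this.append_left [a, a]).trans (Reds.merge a _)

theorem derivable_of_mem_lang {w u : Word} (h : u ∈ lang w) : Derivable w u := by
  obtain ⟨v, s, rfl, hs⟩ := exists_suffix_reds_of_mem_lang w h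
  exact .head (Step.tail v s) (Relation.ReflTransGen.mono (fun _ _ => Red.step) _ _ hs)

/-- The exchange of the two letters. -/
def Letter.swap : Letter → Letter
  | L => R
  | R => L

theorem Letter.swap_swap (c : Letter) : c.swap.swap = c := by cases c <;> rfl

theorem Letter.swap_injective : Function.Injective Letter.swap :=
  Function.LeftInverse.injective Letter.swap_swap

theorem map_swap_mem_lang : ∀ (w : Word) {u : Word},
    u ∈ lang w → u.map Letter.swap ∈ lang (w.map Letter.swap)
  | [], u, h => by simp [(mem_lang_nil u).1 h, mem_lang_nil]
  | [a], u, h => (mem_lang_singleton _ _).2 (((mem_lang_singleton a u).1 h).map _)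
  | [a, b], u, h => (mem_lang_pair _ _ _).2 (((mem_lang_pair a b u).1 h).map _)
  | a :: b :: c :: w, u, h => by
    refine (mem_lang_cons_iff _ _ _ _ _).2 ?_
    rcases (mem_lang_cons_iff a b c w u).1 h with h | ⟨u', h', hu, rfl⟩
    · exact .inl (map_swap_mem_lang (b :: c :: w) h)
    · refine .inr ⟨_, map_swap_mem_lang (b :: c :: w) h', ?_, rfl⟩
      rcases hu with hu | ⟨rfl, hc⟩
      · exact .inl (by rw [List.head?_map, hu]; rfl)
      · exact .inr ⟨rfl, Letter.swap_injective.ne hc⟩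

/-! ### Words and the order of the terms of a sequence -/

section Order

variable {X : Type*} [LinearOrder X]

/-- `y` lies strictly on the side `c` of `x`. -/
def Side : Letter → X → X → Prop
  | L, x, y => y < x
  | R, x, y => x < y

theorem Side.ne {c : Letter} {x y : X} (h : Side c x y) : x ≠ y := by
  cases c
  · exact ne_of_gt h
  · exact ne_of_lt h

/-- All the terms after the `i`-th one lie on the side of it that the `i`-th letter tells, and from
the end of the word on the sequence is constant. -/
def PatTag : Word → (ℕ → X) → Prop
  | [], a => ∀ n, a (n + 1) = a 0
  | c :: w, a => (∀ n, Side c (a 0) (a (n + 1))) ∧ PatTag w (fun n => a (n + 1))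

/-- The letters of the word tell the directions of the successive steps, and the step after the
last one is trivial. -/
def StepTag (f : X → X) : Word → X → Prop
  | [], x => f x = x
  | c :: w, x => Side c x (f x) ∧ StepTag f w (f x)

/-- The sequence of the iterates of a point. -/
abbrev orb (f : X → X) (x : X) : ℕ → X := fun n => f^[n] x

/-- The points between the first term of a sequence and all the other ones. -/
def gap (a : ℕ → X) : Set X := {y | ∀ j, y ∈ uIcc (a 0) (a (j + 1))}

/-- The points between two terms of a sequence. -/
def hull (a : ℕ → X) : Set X := {y | ∃ i j, a i ≤ y ∧ y ≤ a j}

/-- The intermediate value property. -/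
def Darboux (f : X → X) : Prop := ∀ a b y, y ∈ uIcc (f a) (f b) → ∃ c ∈ uIcc a b, f c = y

theorem PatTag.exists_min : ∀ {w : Word} {a : ℕ → X}, PatTag w a → ∃ i, ∀ j, a i ≤ a j
  | [], a, h => ⟨0, fun j => by cases j with | zero => exact le_rfl | succ j => exact (h j).ge⟩
  | R :: w, a, h => ⟨0, fun j => by
      cases j with
      | zero => exact le_rfl
      | succ j => exact (show a 0 < a (j + 1) from h.1 j).le⟩
  | L :: w, a, h => by
    obtain ⟨i, hi⟩ := h.2.exists_min
    refine ⟨i + 1, fun j => ?_⟩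
    cases j with
    | zero => exact (show a (i + 1) < a 0 from h.1 i).le
    | succ j => exact hi j

theorem PatTag.exists_max : ∀ {w : Word} {a : ℕ → X}, PatTag w a → ∃ i, ∀ j, a j ≤ a i
  | [], a, h => ⟨0, fun j => by cases j with | zero => exact le_rfl | succ j => exact (h j).le⟩
  | L :: w, a, h => ⟨0, fun j => by
      cases j with
      | zero => exact le_rfl
      | succ j => exact (show a (j + 1) < a 0 from h.1 j).le⟩
  | R :: w, a, h => by
    obtain ⟨i, hi⟩ := h.2.exists_max
    refine ⟨i + 1, fun j => ?_⟩
    cases j with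
    | zero => exact (show a 0 < a (i + 1) from h.1 i).le
    | succ j => exact hi j

/-- All later terms are on one side of the first, and a nearest one exists since the extrema of the
tail are attained. -/
theorem PatTag.exists_uIcc_subset_gap {w : Word} {a : ℕ → X} (h : PatTag w a) :
    ∃ i, uIcc (a 0) (a (i + 1)) ⊆ gap a := by
  match w, h with
  | [], h => exact ⟨0, fun y hy j => by rw [h 0] at hy; rwa [h j]⟩
  | R :: w, h =>
    obtain ⟨i, hi⟩ := h.2.exists_min
    refine ⟨i, fun y hy j => ?_⟩
    have h1 : a 0 < a (i + 1) := h.1 i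
    have h2 : a 0 < a (j + 1) := h.1 j
    rw [uIcc_of_le h1.le] at hy
    rw [uIcc_of_le h2.le]
    exact ⟨hy.1, hy.2.trans (hi j)⟩
  | L :: w, h =>
    obtain ⟨i, hi⟩ := h.2.exists_max
    refine ⟨i, fun y hy j => ?_⟩
    have h1 : a (i + 1) < a 0 := h.1 i
    have h2 : a (j + 1) < a 0 := h.1 j
    rw [uIcc_of_ge h1.le] at hy
    rw [uIcc_of_ge h2.le]
    exact ⟨(hi j).trans hy.1, hy.2⟩

theorem hull_of_mem (a : ℕ → X) (i : ℕ) : a i ∈ hull a := ⟨i, i, le_rfl, le_rfl⟩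

theorem hull_succ_subset (a : ℕ → X) : hull (fun n => a (n + 1)) ⊆ hull a :=
  fun _ ⟨i, j, h⟩ => ⟨i + 1, j + 1, h⟩

theorem uIcc_subset_hull (a : ℕ → X) (i j : ℕ) : uIcc (a i) (a j) ⊆ hull a := by
  intro y hy
  rcases le_total (a i) (a j) with h | h
  · rw [uIcc_of_le h] at hy
    exact ⟨i, j, hy⟩
  · rw [uIcc_of_ge h] at hy
    exact ⟨j, i, hy⟩

theorem gap_subset_hull (a : ℕ → X) : gap a ⊆ hull a :=
  fun _ hy => uIcc_subset_hull a 0 1 (hy 0)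

/-- The gaps of the tails of a sequence cover its hull. -/
theorem PatTag.exists_mem_gap : ∀ {w : Word} {a : ℕ → X} {y : X}, PatTag w a → y ∈ hull a →
    ∃ k, y ∈ gap (fun n => a (n + k))
  | [], a, y, h, ⟨i, j, hi, hj⟩ => by
    have h' : ∀ i, a i = a 0 := fun i => by
      cases i with
      | zero => rfl
      | succ i => exact h i
    rw [h' i] at hi
    rw [h' j] at hj
    refine ⟨0, fun n => ?_⟩
    rw [le_antisymm hj hi]
    exact left_mem_uIcc
  | R :: w, a, y, h, ⟨i, j, hi, hj⟩ => by
    have h0 : ∀ n, a 0 < a (n + 1) := h.1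
    by_cases hy : y ∈ gap a
    · exact ⟨0, hy⟩
    · have h1 : a 0 ≤ y := by
        refine le_trans ?_ hi
        cases i with
        | zero => exact le_rfl
        | succ i => exact (h0 i).le
      simp only [gap, mem_ofPred_eq, not_forall] at hy
      obtain ⟨n, hn⟩ := hy
      rw [uIcc_of_le (h0 n).le] at hn
      have hn' : a (n + 1) < y := by
        by_contra! hcon
        exact hn ⟨h1, hcon⟩
      -- Outside the first gap, `y` is beyond some later term, hence in the hull of the tail.
      obtain ⟨k, hk⟩ := h.2.exists_mem_gap (y := y) (by
        cases j with
        | zero => exact absurd (hn'.trans_le hj) (h0 n).not_gt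
        | succ j => exact ⟨n, j, hn'.le, hj⟩)
      exact ⟨k + 1, hk⟩
  | L :: w, a, y, h, ⟨i, j, hi, hj⟩ => by
    have h0 : ∀ n, a (n + 1) < a 0 := h.1
    by_cases hy : y ∈ gap a
    · exact ⟨0, hy⟩
    · have h1 : y ≤ a 0 := by
        refine hj.trans ?_
        cases j with
        | zero => exact le_rfl
        | succ j => exact (h0 j).le
      simp only [gap, mem_ofPred_eq, not_forall] at hy
      obtain ⟨n, hn⟩ := hy
      rw [uIcc_of_ge (h0 n).le] at hn
      have hn' : y < a (n + 1) := by
        by_contra! hcon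
        exact hn ⟨hcon, h1⟩
      obtain ⟨k, hk⟩ := h.2.exists_mem_gap (y := y) (by
        cases i with
        | zero => exact absurd (hi.trans_lt hn') (h0 n).not_gt
        | succ i => exact ⟨i, n, hi, hn'.le⟩)
      exact ⟨k + 1, hk⟩

theorem PatTag.exists_drop {w : Word} {a : ℕ → X} (h : PatTag w a) (k : ℕ) :
    ∃ w', PatTag w' (fun n => a (n + k)) := by
  induction k generalizing w a with
  | zero => exact ⟨w, h⟩
  | succ k ih =>
    match w, h with
    | [], h => exact ⟨[], fun n => (h (n + 1 + k)).trans (h (0 + k)).symm⟩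
    | c :: w, h => exact ih h.2

theorem PatTag.drop_append (v : Word) {s : Word} {a : ℕ → X} (h : PatTag (v ++ s) a) :
    PatTag s (fun n => a (n + v.length)) := by
  induction v generalizing a with
  | nil => exact h
  | cons c v ih => exact ih h.2

/-! ### Derivable words are forced -/

variable {f : X → X}

/-- The gap contains the interval from `x` to its nearest later term. The image of that interval
joins `f x` to one of its later terms, so it covers the next gap. -/
theorem exists_mem_gap_of_mem_gap (hf : Darboux f) {w : Word} {x y : X} (h : PatTag w (orb f x))
    (hy : y ∈ gap (orb f (f x))) : ∃ z ∈ gap (orb f x), f z = y := by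
  obtain ⟨i, hi⟩ := h.exists_uIcc_subset_gap
  obtain ⟨z, hz, hzy⟩ := hf x (f^[i + 1] x) y (by
    rw [← Function.iterate_succ_apply' f]
    exact hy i)
  exact ⟨z, hi hz, hzy⟩

/-- `z` is a point of the gap of the orbit of `x` whose orbit follows the word `s` and stays in the
hull of the orbit of `x`, and which is not fixed. -/
structure GapPoint (f : X → X) (x : X) (s : Word) (z : X) : Prop where
  mem_gap : z ∈ gap (orb f x)
  ne : f z ≠ z
  patTag : PatTag s (orb f z)
  mem_hull : ∀ n, f^[n] z ∈ hull (orb f x)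

/-- The point `y` separates `x` from the later terms, and the orbit of `f y` stays in their hull;
`hn` makes the separation strict. -/
theorem gapPoint_cons {c : Letter} {s s' : Word} {x y : X} (h : PatTag (c :: s) (orb f x))
    (hg : y ∈ gap (orb f x)) (hne : f y ≠ y) (hs : PatTag s' (orb f (f y)))
    (hh : ∀ n, f^[n] (f y) ∈ hull (orb f (f x))) (hn : ∀ n, f^[n] (f y) ≠ y) :
    GapPoint f x (c :: s') y := by
  refine ⟨hg, hne, ⟨fun n => ?_, hs⟩, fun n => ?_⟩
  · obtain ⟨i, j, hi, hj⟩ := hh n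
    cases c
    · have h1 : f^[j + 1] x < x := h.1 j
      have h2 : y ∈ uIcc x (f^[j + 1] x) := hg j
      rw [uIcc_of_ge h1.le] at h2
      exact lt_of_le_of_ne (hj.trans h2.1) (hn n)
    · have h1 : x < f^[i + 1] x := h.1 i
      have h2 : y ∈ uIcc x (f^[i + 1] x) := hg i
      rw [uIcc_of_le h1.le] at h2
      exact lt_of_le_of_ne (h2.2.trans hi) (hn n).symm
  · cases n with
    | zero => exact gap_subset_hull _ hg
    | succ n => exact hull_succ_subset _ (hh n)

theorem GapPoint.exists_cons (hf : Darboux f) {c : Letter} {s s' : Word} {x z : X}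
    (h : PatTag (c :: s) (orb f x)) (hz : GapPoint f (f x) s' z) :
    ∃ y, GapPoint f x (c :: s') y := by
  obtain ⟨y, hy, rfl⟩ := exists_mem_gap_of_mem_gap hf h hz.mem_gap
  refine ⟨y, gapPoint_cons h hy (fun hyy => hz.ne (by rw [hyy, hyy])) hz.patTag hz.mem_hull ?_⟩
  intro n hn
  -- A return to `y` would make `f y` periodic, which neither a first letter nor the non-fixedness
  -- of `f y` permits.
  match s', hz.patTag with
  | [], h' => exact hz.ne (h' 0)
  | d :: s', h' =>
    refine (h'.1 n).ne ?_
    change f y = f^[n + 1] (f y)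
    rw [Function.iterate_succ_apply', hn]

theorem GapPoint.exists_append (hf : Darboux f) (v : Word) {s s' : Word} {x z : X}
    (h : PatTag (v ++ s) (orb f x)) (hz : GapPoint f (f^[v.length] x) s' z) :
    ∃ y, GapPoint f x (v ++ s') y := by
  induction v generalizing x with
  | nil => exact ⟨z, hz⟩
  | cons c v ih =>
    obtain ⟨y, hy⟩ := ih h.2 hz
    exact hy.exists_cons hf h

omit [LinearOrder X] in
theorem orb_iterate (f : X → X) (x : X) (k : ℕ) : (fun n => orb f x (n + k)) = orb f (f^[k] x) := by
  funext n
  exact Function.iterate_add_apply f n k x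

/-- With two equal letters, the second term lies between the first one and the rest, so it is a gap
point and can replace the first. -/
theorem exists_patTag_merge (hf : Darboux f) (c : Letter) (v v' : Word) {x : X}
    (h : PatTag (v ++ c :: c :: v') (orb f x)) : ∃ y, PatTag (v ++ c :: v') (orb f y) := by
  have h' := h.drop_append v
  rw [orb_iterate] at h'
  obtain ⟨y, hy⟩ := GapPoint.exists_append (z := f (f^[v.length] x)) (s' := c :: v') hf v h (by
    set x' := f^[v.length] x
    refine ⟨fun j => ?_, (h'.2.1 0).ne.symm, h'.2, fun n => hull_of_mem (orb f x') (n + 1)⟩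
    cases j with
    | zero => exact right_mem_uIcc
    | succ j =>
      have h1 := h'.1 (j + 1)
      have h2 := h'.1 0
      have h3 := h'.2.1 j
      cases c
      · rw [uIcc_of_ge (le_of_lt h1)]
        exact ⟨le_of_lt h3, le_of_lt h2⟩
      · rw [uIcc_of_le (le_of_lt h1)]
        exact ⟨le_of_lt h2, le_of_lt h3⟩)
  exact ⟨y, hy.patTag⟩

theorem exists_gapPoint_cancel (hf : Darboux f) {e c d : Letter} (hcd : c ≠ d) (v' : Word) {x : X}
    (h : PatTag (e :: c :: d :: v') (orb f x)) : ∃ y, GapPoint f x (e :: v') y := by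
  by_cases hed : e = d
  · subst hed
    -- For `e = d`, the third term already lies between `x` and the other later terms.
    refine ⟨f (f x), fun j => ?_, (h.2.2.1 0).ne.symm, h.2.2,
      fun n => hull_of_mem (orb f x) (n + 2)⟩
    have h1 := h.1 1
    have h2 := h.1 j
    match j with
    | 0 =>
      have h3 := h.2.1 0
      cases e <;> cases c
      · exact absurd rfl hcd
      · rw [uIcc_of_ge (le_of_lt h2)]
        exact ⟨le_of_lt h3, le_of_lt h1⟩
      · rw [uIcc_of_le (le_of_lt h2)]
        exact ⟨le_of_lt h1, le_of_lt h3⟩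
      · exact absurd rfl hcd
    | 1 => exact right_mem_uIcc
    | j + 2 =>
      have h3 := h.2.2.1 j
      cases e
      · rw [uIcc_of_ge (le_of_lt h2)]
        exact ⟨le_of_lt h3, le_of_lt h1⟩
      · rw [uIcc_of_le (le_of_lt h2)]
        exact ⟨le_of_lt h1, le_of_lt h3⟩
  · obtain rfl := Letter.eq_of_ne_of_ne hed hcd
    have h01 : Side e x (f x) := h.1 0
    have h13 := h.2.1 1
    have h23 := h.2.2.1 0
    -- For `e = c`, the fourth term lies between the second and the third, so a point between `x`
    -- and `f x` maps directly onto it.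
    obtain ⟨y, hy, hfy⟩ := hf x (f x) (f (f (f x))) (by
      cases e <;> cases d
      · exact absurd rfl hcd
      · exact Icc_subset_uIcc' ⟨le_of_lt h23, le_of_lt h13⟩
      · exact Icc_subset_uIcc ⟨le_of_lt h13, le_of_lt h23⟩
      · exact absurd rfl hcd)
    have hside : ∀ n, f^[n] (f y) ≠ y := by
      intro n hn
      have h1 : Side e (f x) (f^[n] (f y)) := by rw [hfy]; exact h.2.1 (n + 1)
      rw [hn] at h1
      cases e
      · rw [uIcc_of_ge (le_of_lt h01)] at hy
        exact not_lt_of_ge hy.1 h1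
      · rw [uIcc_of_le (le_of_lt h01)] at hy
        exact not_lt_of_ge hy.2 h1
    refine ⟨y, gapPoint_cons h (fun j => ?_) (hside 0) (by rw [hfy]; exact h.2.2.2) (fun n => ?_)
      hside⟩
    · cases j with
      | zero => exact hy
      | succ j =>
        have h1 := h.2.1 j
        have h2 := h.1 (j + 1)
        cases e
        · rw [uIcc_of_ge (le_of_lt h01)] at hy
          rw [uIcc_of_ge (le_of_lt h2)]
          exact ⟨(le_of_lt h1).trans hy.1, hy.2⟩
        · rw [uIcc_of_le (le_of_lt h01)] at hy
          rw [uIcc_of_le (le_of_lt h2)]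
          exact ⟨hy.1, hy.2.trans (le_of_lt h1)⟩
    · rw [hfy]
      exact hull_of_mem (orb f (f x)) (n + 2)

theorem exists_patTag_cancel (hf : Darboux f) {c d : Letter} (hcd : c ≠ d) (v v' : Word) {x : X}
    (h : PatTag (v ++ c :: d :: v') (orb f x)) : ∃ y, PatTag (v ++ v') (orb f y) := by
  rcases List.eq_nil_or_concat' v with rfl | ⟨v, e, rfl⟩
  · exact ⟨f (f x), h.2.2⟩
  · rw [List.append_assoc] at h ⊢
    have h' := h.drop_append v
    rw [orb_iterate] at h'
    obtain ⟨z, hz⟩ := exists_gapPoint_cancel hf hcd v' h'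
    obtain ⟨y, hy⟩ := hz.exists_append hf v h
    exact ⟨y, hy.patTag⟩

theorem exists_patTag_of_derivable (hf : Darboux f) {w u : Word} (hwu : Derivable w u)
    (h : ∃ x, PatTag w (orb f x)) : ∃ x, PatTag u (orb f x) := by
  induction hwu with
  | refl => exact h
  | tail _ hs ih =>
    obtain ⟨x, hx⟩ := ih
    cases hs with
    | redRR v v' => simpa using exists_patTag_merge hf R v v' (by simpa using hx)
    | redLL v v' => simpa using exists_patTag_merge hf L v v' (by simpa using hx)
    | redLR v v' =>
      exact exists_patTag_cancel (c := L) (d := R) hf (by simp) v v' (by simpa using hx)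
    | redRL v v' =>
      exact exists_patTag_cancel (c := R) (d := L) hf (by simp) v v' (by simpa using hx)
    | tail v v' =>
      refine ⟨f^[v.length] x, ?_⟩
      rw [← orb_iterate]
      exact hx.drop_append v

/-! ### Orbits of maps all of whose points are eventually fixed -/

omit [LinearOrder X] in
theorem iterate_eq_of_fixed {y : X} {m : ℕ} (h : f (f^[m] y) = f^[m] y) {n : ℕ} (hn : m ≤ n) :
    f^[n] y = f^[m] y := by
  obtain ⟨k, rfl⟩ := Nat.exists_eq_add_of_le' hn
  rw [Function.iterate_add_apply]
  exact Function.iterate_fixed h k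

omit [LinearOrder X] in
theorem exists_iterate_mem {g : X → X} {K : ℕ → Set X} (hK : ∀ n, K (n + 1) ⊆ g '' K n) (n : ℕ) :
    ∀ z ∈ K n, ∃ y, g^[n] y = z ∧ ∀ i ≤ n, g^[i] y ∈ K i := by
  induction n with
  | zero => exact fun z hz => ⟨z, rfl, fun i hi => by rwa [Nat.le_zero.1 hi]⟩
  | succ n ih =>
    intro z hz
    obtain ⟨z', hz', rfl⟩ := hK n hz
    obtain ⟨y, rfl, hy⟩ := ih z' hz'
    refine ⟨y, Function.iterate_succ_apply' g n y, fun i hi => ?_⟩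
    rcases Nat.le_succ_iff.1 hi with hi | rfl
    · exact hy i hi
    · rwa [Function.iterate_succ_apply']

/-- Finite itineraries are realized by pulling back; compactness of the nested sets realizes the
infinite one. -/
theorem exists_forall_iterate_mem {Y : Type*} [TopologicalSpace Y] [LinearOrder Y] {g : Y → Y}
    (hg : Continuous g) {K : ℕ → Set Y} (hK : ∀ n, K (n + 1) ⊆ g '' K n) (hc : ∀ n, IsClosed (K n))
    (h0 : IsCompact (K 0)) (hne : ∀ n, (K n).Nonempty) : ∃ y, ∀ n, g^[n] y ∈ K n := by
  have hcl : ∀ n, IsClosed {y | ∀ i ≤ n, g^[i] y ∈ K i} := fun n => by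
    simp only [ofPred_forall]
    exact isClosed_iInter fun i => isClosed_iInter fun _ => (hc i).preimage (hg.iterate i)
  obtain ⟨y, hy⟩ := IsCompact.nonempty_iInter_of_sequence_nonempty_isCompact_isClosed
    (fun n => {y | ∀ i ≤ n, g^[i] y ∈ K i}) (fun n y hy i hi => hy i (hi.trans n.le_succ))
    (fun n => by
      obtain ⟨z, hz⟩ := hne n
      obtain ⟨y, -, hy⟩ := exists_iterate_mem hK n z hz
      exact ⟨y, hy⟩)
    (h0.of_isClosed_subset (hcl 0) fun y hy => hy 0 le_rfl) hcl
  exact ⟨y, fun n => mem_iInter.1 hy n n le_rfl⟩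

theorem exists_iterate_eq_of_mem_gap (hf : Darboux f) {w : Word} {x z : X} (k : ℕ)
    (h : PatTag w (orb f x)) (hz : z ∈ gap (orb f (f^[k] x))) :
    ∃ y ∈ gap (orb f x), f^[k] y = z := by
  induction k generalizing w x with
  | zero => exact ⟨z, hz, rfl⟩
  | succ k ih =>
    obtain ⟨w', hw'⟩ := h.exists_drop 1
    obtain ⟨y', hy', rfl⟩ := ih hw' hz
    obtain ⟨y, hy, rfl⟩ := exists_mem_gap_of_mem_gap hf h hy'
    exact ⟨y, hy, rfl⟩

variable [TopologicalSpace X] [OrderClosedTopology X] [CompactIccSpace X]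

/-- If every point is eventually fixed, then a point whose image is not fixed lies outside of the
hull of the orbit of its image. -/
theorem not_mem_hull_of_eventually_fixed (hc : Continuous f) (hf : Darboux f)
    (hef : ∀ x, ∃ n, f (f^[n] x) = f^[n] x) {w : Word} {x : X} (hx : f x ≠ x)
    (h : PatTag w (orb f (f x))) : x ∉ hull (orb f (f x)) := by
  intro hmem
  obtain ⟨k, hk⟩ := h.exists_mem_gap hmem
  rw [orb_iterate] at hk
  obtain ⟨w', hw'⟩ := h.exists_drop k
  rw [orb_iterate] at hw'
  obtain ⟨i, hi⟩ := hw'.exists_uIcc_subset_gap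
  set q := f^[k] (f x) with hq
  set p := f^[i + 1] q with hp
  have hxp : x ∈ uIcc q p := hk i
  have hA : uIcc x q ⊆ uIcc q p := uIcc_subset_uIcc hxp left_mem_uIcc
  have hB : uIcc x p ⊆ uIcc q p := uIcc_subset_uIcc hxp right_mem_uIcc
  -- One application of `f` covers the gap of the orbit of `f x`, and `k` more cover that of `q`.
  -- The cases `j = 0` and `j = i + 1` give the intervals ending at `q` and at `p`.
  have key : ∀ j, gap (orb f q) ⊆ f^[k + 1] '' uIcc x (f^[j] q) := by
    intro j z hz
    obtain ⟨y, hy, rfl⟩ := exists_iterate_eq_of_mem_gap hf k h hz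
    obtain ⟨y', hy', rfl⟩ := hf x (f^[j] q) y (by
      have := hy (j + k)
      have e : f (f^[j] q) = orb f (f x) (j + k + 1) := by
        change _ = f^[j + k + 1] (f x)
        rw [Function.iterate_succ_apply', Function.iterate_add_apply]
      rwa [e])
    exact ⟨y', hy', rfl⟩
  obtain ⟨y, hy⟩ := exists_forall_iterate_mem (hc.iterate (k + 1))
    (K := fun n => if Even n then uIcc x q else uIcc x p)
    (fun n => by
      by_cases hn : Even n
      · simp only [hn, Nat.even_add_one, not_true, if_true, if_false]
        exact (hB.trans hi).trans (key 0)
      · simp only [hn, Nat.even_add_one, not_false_eq_true, if_true, if_false]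
        exact (hA.trans hi).trans (key (i + 1)))
    (fun n => by split_ifs <;> exact isClosed_Icc)
    (by simpa using isCompact_uIcc)
    (fun n => by split_ifs <;> exact nonempty_uIcc)
  obtain ⟨m, hm⟩ := hef y
  have e : ∀ n, m ≤ n → (f^[k + 1])^[n] y = f^[m] y := fun n hn => by
    rw [← Function.iterate_mul]
    exact iterate_eq_of_fixed hm (hn.trans (Nat.le_mul_of_pos_left n k.succ_pos))
  have h1 := hy (2 * m)
  have h2 := hy (2 * m + 1)
  rw [e _ (by omega)] at h1 h2
  rw [if_pos (even_two_mul m)] at h1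
  rw [if_neg (by simp)] at h2
  -- The final fixed point lies in both intervals, which meet only at `x`.
  have : f^[m] y = x := by
    rcases le_total q p with hqp | hqp
    · rw [uIcc_of_le hqp] at hxp
      rw [uIcc_of_ge hxp.1] at h1
      rw [uIcc_of_le hxp.2] at h2
      exact le_antisymm h1.2 h2.1
    · rw [uIcc_of_ge hqp] at hxp
      rw [uIcc_of_le hxp.2] at h1
      rw [uIcc_of_ge hxp.1] at h2
      exact le_antisymm h2.2 h1.1
  rw [this] at hm
  exact hx hm

theorem StepTag.patTag (hc : Continuous f) (hf : Darboux f)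
    (hef : ∀ x, ∃ n, f (f^[n] x) = f^[n] x) : ∀ {w : Word} {x : X}, StepTag f w x →
      PatTag w (orb f x)
  | [], x, h => fun n => Function.iterate_fixed h (n + 1)
  | c :: w, x, h => by
    have ih := StepTag.patTag hc hf hef h.2
    have hx : x ∉ hull (orb f (f x)) :=
      not_mem_hull_of_eventually_fixed hc hf hef h.1.ne.symm ih
    refine ⟨fun n => ?_, ih⟩
    have h1 := h.1
    cases c
    · by_contra hn
      exact hx ⟨0, n, le_of_lt h1, not_lt.1 hn⟩
    · by_contra hn
      exact hx ⟨n, 0, not_lt.1 hn, le_of_lt h1⟩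

end Order

/-! ### Existence and uniqueness of the word followed by a point -/

theorem exists_stepTag {X : Type*} [LinearOrder X] {f : X → X} {n : ℕ} {x : X}
    (h : f (f^[n] x) = f^[n] x) : ∃ w, StepTag f w x := by
  induction n generalizing x with
  | zero => exact ⟨[], h⟩
  | succ n ih =>
    obtain ⟨w, hw⟩ := ih h
    rcases lt_trichotomy (f x) x with h1 | h1 | h1
    · exact ⟨L :: w, h1, hw⟩
    · exact ⟨[], h1⟩
    · exact ⟨R :: w, h1, hw⟩

theorem StepTag.exists_fixed {X : Type*} [LinearOrder X] {f : X → X} : ∀ {w : Word} {x : X},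
    StepTag f w x → ∃ n, f (f^[n] x) = f^[n] x
  | [], _, h => ⟨0, h⟩
  | _ :: _, _, h => by
    obtain ⟨n, hn⟩ := h.2.exists_fixed
    exact ⟨n + 1, hn⟩

theorem StepTag.unique {X : Type*} [LinearOrder X] {f : X → X} : ∀ {w u : Word} {x : X},
    StepTag f w x → StepTag f u x → w = u
  | [], [], _, _, _ => rfl
  | [], _ :: _, _, h, h' => absurd h.symm h'.1.ne
  | _ :: _, [], _, h, h' => absurd h'.symm h.1.ne
  | c :: w, d :: u, x, h, h' => by
    rw [h.2.unique h'.2]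
    have h1 := h.1
    have h2 := h'.1
    cases c <;> cases d
    · rfl
    · exact absurd h1 (lt_asymm h2)
    · exact absurd h1 (lt_asymm h2)
    · rfl

/-! ### A map that admits only the constructed words -/

/-- `F` is a continuous self-map of `[m, M]` with `0` as its only fixed point, the point `x` follows
the word `w` and is an extreme point of `[m, M]`, and every point of `[m, M]` follows a word
of `lang w`. -/
structure Model (w : Word) (F : ℝ → ℝ) (m M x : ℝ) : Prop where
  cont : Continuous F
  nonpos : m ≤ 0
  nonneg : 0 ≤ M
  maps : ∀ t, m ≤ t → t ≤ M → m ≤ F t ∧ F t ≤ M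
  zero : F 0 = 0
  lt_apply : ∀ t, m ≤ t → t < 0 → t < F t
  apply_lt : ∀ t, t ≤ M → 0 < t → F t < t
  tag : StepTag F w x
  head_nil : w = [] → x = 0
  head_L : w.head? = some L → x = M
  head_R : w.head? = some R → x = m
  not_mem_L : L ∉ w → M = 0
  not_mem_R : R ∉ w → m = 0
  mem_lang : ∀ t, m ≤ t → t ≤ M → ∃ u ∈ lang w, StepTag F u t

theorem model_nil : Model [] (fun _ => 0) 0 0 0 where
  cont := continuous_const
  nonpos := le_rfl
  nonneg := le_rfl
  maps _ _ _ := ⟨le_rfl, le_rfl⟩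
  zero := rfl
  lt_apply _ _ h := h
  apply_lt _ _ h := h
  tag := rfl
  head_nil _ := rfl
  head_L h := rfl
  head_R h := rfl
  not_mem_L _ := rfl
  not_mem_R _ := rfl
  mem_lang t h h' := ⟨[], by simp [lang], le_antisymm h h'⟩

theorem StepTag.neg {F : ℝ → ℝ} : ∀ {w : Word} {x : ℝ}, StepTag F w x →
    StepTag (fun t => -F (-t)) (w.map Letter.swap) (-x)
  | [], x, h => by
    have h : F x = x := h
    simp [StepTag, h]
  | c :: w, x, h => by
    refine ⟨?_, ?_⟩
    · have h1 := h.1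
      cases c
      · simpa [Side, Letter.swap] using h1
      · simpa [Side, Letter.swap] using h1
    · simpa using h.2.neg

theorem Letter.mem_map_swap {c : Letter} {w : Word} : c ∈ w.map Letter.swap ↔ c.swap ∈ w := by
  rw [List.mem_map]
  exact ⟨fun ⟨d, hd, h⟩ => by rwa [← h, Letter.swap_swap], fun h => ⟨_, h, c.swap_swap⟩⟩

theorem Letter.head?_map_swap {c : Letter} {w : Word} (h : (w.map Letter.swap).head? = some c) :
    w.head? = some c.swap := by
  cases w with
  | nil => simp at h
  | cons d w =>
    simp only [List.map_cons, List.head?_cons, Option.some.injEq] at h ⊢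
    rw [← h, Letter.swap_swap]

theorem Model.neg {w : Word} {F : ℝ → ℝ} {m M x : ℝ} (h : Model w F m M x) :
    Model (w.map Letter.swap) (fun t => -F (-t)) (-M) (-m) (-x) where
  cont := (h.cont.comp continuous_neg).neg
  nonpos := neg_nonpos.2 h.nonneg
  nonneg := neg_nonneg.2 h.nonpos
  maps t h1 h2 := by
    have := h.maps (-t) (by linarith) (by linarith)
    constructor <;> linarith
  zero := by simp [h.zero]
  lt_apply t h1 h2 := by
    have := h.apply_lt (-t) (by linarith) (by linarith)
    linarith
  apply_lt t h1 h2 := by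
    have := h.lt_apply (-t) (by linarith) (by linarith)
    linarith
  tag := h.tag.neg
  head_nil hw := by rw [h.head_nil (by simpa using hw), neg_zero]
  head_L hw := by rw [h.head_R (Letter.head?_map_swap hw)]
  head_R hw := by rw [h.head_L (Letter.head?_map_swap hw)]
  not_mem_L hw := by rw [h.not_mem_R fun h' => hw (Letter.mem_map_swap.2 h'), neg_zero]
  not_mem_R hw := by rw [h.not_mem_L fun h' => hw (Letter.mem_map_swap.2 h'), neg_zero]
  mem_lang t h1 h2 := by
    obtain ⟨u, hu, ht⟩ := h.mem_lang (-t) (by linarith) (by linarith)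
    exact ⟨_, map_swap_mem_lang _ hu, by simpa using ht.neg⟩

theorem Model.stepTag_congr {w : Word} {F G : ℝ → ℝ} {m M x : ℝ} (h : Model w F m M x)
    (hG : ∀ t ≤ M, G t = F t) : ∀ {u : Word} {t : ℝ}, m ≤ t → t ≤ M → StepTag F u t → StepTag G u t
  | [], t, _, h2, ht => (hG t h2).trans ht
  | _ :: _, t, h1, h2, ht => by
    have h3 := h.maps t h1 h2
    refine ⟨?_, ?_⟩
    · rw [hG t h2]
      exact ht.1
    · rw [hG t h2]
      exact h.stepTag_congr hG h3.1 h3.2 ht.2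

theorem Model.mem_Icc {w : Word} {F : ℝ → ℝ} {m M x : ℝ} (h : Model w F m M x) :
    m ≤ x ∧ x ≤ M := by
  match w, h with
  | [], h => rw [h.head_nil rfl]; exact ⟨h.nonpos, h.nonneg⟩
  | L :: w, h => rw [h.head_L rfl]; exact ⟨h.nonpos.trans h.nonneg, le_rfl⟩
  | R :: w, h => rw [h.head_R rfl]; exact ⟨le_rfl, h.nonpos.trans h.nonneg⟩

/-- Positive points move left without being fixed, so an orbit that ends at a fixed point must leave
the positive half-line. -/
theorem Model.exists_apply_nonpos {w : Word} {F : ℝ → ℝ} {m M x : ℝ} (h : Model w F m M x) :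
    ∀ {u : Word} {t : ℝ}, t ≤ M → 0 < t → StepTag F u t → ∃ q, 0 < q ∧ q ≤ M ∧ F q ≤ 0
  | [], t, h1, h2, ht => absurd ht (h.apply_lt t h1 h2).ne
  | _ :: _, t, h1, h2, ht => by
    rcases le_or_gt (F t) 0 with h3 | h3
    · exact ⟨t, h2, h1, h3⟩
    · exact h.exists_apply_nonpos ((h.apply_lt t h1 h2).le.trans h1) h3 ht.2

/-- A point `s` with `0 ≤ s < F M` is the image of a positive point. -/
theorem Model.cons_L_mem_lang {w : Word} {F : ℝ → ℝ} {m M x : ℝ} (h : Model w F m M x)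
    {u : Word} {s : ℝ} (hu : StepTag F u s) (h0 : 0 ≤ s) (hs : s < F M) : L :: u ∈ lang w := by
  have hM : 0 < M := lt_of_le_of_ne h.nonneg fun h' => by
    rw [← h', h.zero] at hs
    exact absurd h0 hs.not_ge
  obtain ⟨v, -, hv⟩ := h.mem_lang M (h.nonpos.trans hM.le) le_rfl
  obtain ⟨q, hq, hqM, hFq⟩ := h.exists_apply_nonpos le_rfl hM hv
  obtain ⟨t, ht, rfl⟩ := intermediate_value_Icc hqM h.cont.continuousOn ⟨hFq.trans h0, hs.le⟩
  have h1 : 0 < t := hq.trans_le ht.1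
  obtain ⟨u', hu', ht'⟩ := h.mem_lang t (h.nonpos.trans h1.le) ht.2
  have : StepTag F (L :: u) t := ⟨h.apply_lt t ht.2 h1, hu⟩
  rwa [this.unique ht']

theorem Model.eq_zero_of_fixed {w : Word} {F : ℝ → ℝ} {m M x : ℝ} (h : Model w F m M x)
    {t : ℝ} (h1 : m ≤ t) (h2 : t ≤ M) (h0 : F t = t) : t = 0 := by
  rcases lt_trichotomy t 0 with h3 | h3 | h3
  · exact absurd h0 (h.lt_apply t h1 h3).ne'
  · exact h3
  · exact absurd h0 (h.apply_lt t h2 h3).ne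

theorem Model.head_of_pos {w u : Word} {F : ℝ → ℝ} {m M x t : ℝ} (h : Model w F m M x)
    (h2 : t ≤ M) (h0 : 0 < t) (hu : StepTag F u t) : u.head? = some L := by
  have h3 := h.apply_lt t h2 h0
  match u, hu with
  | [], hu => exact absurd hu h3.ne
  | L :: u, hu => rfl
  | R :: u, hu => exact absurd hu.1 h3.not_gt

theorem Model.head_of_neg {w u : Word} {F : ℝ → ℝ} {m M x t : ℝ} (h : Model w F m M x)
    (h2 : m ≤ t) (h0 : t < 0) (hu : StepTag F u t) : u.head? = some R := by
  have h3 := h.lt_apply t h2 h0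
  match u, hu with
  | [], hu => exact absurd hu h3.ne'
  | L :: u, hu => exact absurd hu.1 h3.not_gt
  | R :: u, hu => rfl

/-- If `[m, M]` is extended to the right by an interval mapped linearly onto the one from `F M` to
`x`, then the words of the new points belong to `lang (L :: w)`. -/
theorem Model.cons_L_mem_lang_cons {w u : Word} {F : ℝ → ℝ} {m M x r s : ℝ} (h : Model w F m M x)
    (hr0 : 0 < r) (hs : s = F M + r * (x - F M)) (h1 : m ≤ s) (h2 : s ≤ M)
    (hu : u ∈ lang w) (hus : StepTag F u s) : L :: u ∈ lang (L :: w) := by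
  match w, h with
  | [], h =>
    rw [(mem_lang_nil u).1 hu, mem_lang_singleton]
  | [b], h =>
    have hx : F x = 0 := by
      have hx := h.mem_Icc
      have hm := h.maps x hx.1 hx.2
      exact h.eq_zero_of_fixed hm.1 hm.2 h.tag.2
    have hx0 : x ≠ 0 := by
      rintro rfl
      exact h.tag.1.ne h.zero.symm
    have hM : F M = 0 := by
      cases b
      · rw [← h.head_L rfl, hx]
      · rw [h.not_mem_L (by simp), h.zero]
    have hs0 : s ≠ 0 := by
      rw [hs, hM]
      simpa using ⟨hr0.ne', hx0⟩
    have hul := (mem_lang_singleton b u).1 hu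
    rw [List.suffix_cons_iff] at hul
    rcases hul with rfl | hul
    · rw [mem_lang_pair]
    · rw [List.suffix_nil.1 hul] at hus
      exact absurd (h.eq_zero_of_fixed h1 h2 hus) hs0
  | L :: c :: w, h =>
    refine (mem_lang_cons_iff _ _ _ _ _).2 (.inr ⟨u, hu, ?_, rfl⟩)
    cases c
    · left
      have hx := h.head_L rfl
      have hm := h.maps M (h.nonpos.trans h.nonneg) le_rfl
      -- The second letter is `L`, so `F M` moves left and must be positive; `s` lies between `F M`
      -- and `x = M` or beyond, hence is positive too.
      have hFM : 0 < F M := by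
        by_contra hcon
        have h3 : F (F M) < F M := hx ▸ h.tag.2.1
        rcases (not_lt.1 hcon).lt_or_eq with h4 | h4
        · exact absurd h3 (h.lt_apply _ hm.1 h4).not_gt
        · rw [h4, h.zero] at h3
          exact lt_irrefl _ h3
      refine h.head_of_pos h2 ?_ hus
      rw [hs, hx]
      have := mul_nonneg hr0.le (sub_nonneg.2 hm.2)
      linarith
    · exact .inr ⟨rfl, by simp⟩
  | R :: c :: w, h =>
    rcases lt_or_ge s 0 with h0 | h0
    · exact (mem_lang_cons_iff _ _ _ _ _).2 (.inr ⟨u, hu, .inl (h.head_of_neg h1 h0 hus), rfl⟩)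
    -- As `x < 0 ≤ s`, the linear piece descends and `s < F M`: an old positive point already
    -- follows this word.
    · refine mem_lang_cons_of_mem L (h.cons_L_mem_lang hus h0 ?_)
      have hx := h.head_R rfl
      have hxm := h.mem_Icc
      have hm0 : x < 0 := by
        refine lt_of_le_of_ne (hx ▸ h.nonpos) fun h' => ?_
        exact h.tag.1.ne (by rw [h', h.zero])
      have hm := h.maps M (h.nonpos.trans h.nonneg) le_rfl
      by_contra hcon
      have h3 : 0 ≤ r * (x - F M) := by linarith
      have h4 : x - F M < 0 := by
        by_contra h5
        have h6 : F M = x := by linarith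
        rw [h6] at hs
        simp only [sub_self, mul_zero, add_zero] at hs
        linarith
      exact absurd h3 (mul_neg_of_pos_of_neg hr0 h4).not_ge

/-- A unit interval is attached at the right and mapped linearly from `F M` to `x`. Its points land
in the old interval, hence move left, and its endpoint goes to `x`. -/
theorem Model.cons_L {w : Word} {F : ℝ → ℝ} {m M x : ℝ} (h : Model w F m M x) :
    ∃ G, Model (L :: w) G m (M + 1) (M + 1) := by
  set G : ℝ → ℝ := fun t => if t ≤ M then F t else F M + (t - M) * (x - F M) with hGdef
  have hG : ∀ t ≤ M, G t = F t := fun t ht => if_pos ht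
  have hG' : ∀ t, M < t → G t = F M + (t - M) * (x - F M) := fun t ht => if_neg ht.not_ge
  have hx := h.mem_Icc
  have hFM := h.maps M (h.nonpos.trans h.nonneg) le_rfl
  have hmaps : ∀ t, m ≤ t → t ≤ M + 1 → m ≤ G t ∧ G t ≤ M := fun t h1 h2 => by
    rcases le_or_gt t M with h3 | h3
    · rw [hG t h3]
      exact h.maps t h1 h3
    · rw [hG' t h3]
      constructor
      · nlinarith [mul_nonneg (sub_nonneg.2 h3.le) (sub_nonneg.2 hx.1),
          mul_nonneg (sub_nonneg.2 h2) (sub_nonneg.2 hFM.1)]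
      · nlinarith [mul_nonneg (sub_nonneg.2 h3.le) (sub_nonneg.2 hx.2),
          mul_nonneg (sub_nonneg.2 h2) (sub_nonneg.2 hFM.2)]
  have hGx : G (M + 1) = x := by
    rw [hG' _ (lt_add_one M)]
    ring
  refine ⟨G, ?_, h.nonpos, by linarith [h.nonneg], fun t h1 h2 => ?_, ?_, fun t h1 h2 => ?_,
    fun t h1 h2 => ?_, ?_, by simp, fun _ => rfl, by simp, by simp,
    fun h' => h.not_mem_R fun hR => h' (List.mem_cons_of_mem _ hR), fun t h1 h2 => ?_⟩
  · refine Continuous.if_le h.cont (by fun_prop) continuous_id continuous_const ?_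
    rintro t rfl
    simp
  · have := hmaps t h1 h2
    exact ⟨this.1, by linarith [this.2]⟩
  · rw [hG 0 h.nonneg, h.zero]
  · rw [hG t (h2.le.trans h.nonneg)]
    exact h.lt_apply t h1 h2
  · rcases le_or_gt t M with h3 | h3
    · rw [hG t h3]
      exact h.apply_lt t h3 h2
    · exact (hmaps t (h.nonpos.trans h2.le) h1).2.trans_lt h3
  · refine ⟨?_, ?_⟩
    · rw [hGx]
      exact hx.2.trans_lt (lt_add_one M)
    · rw [hGx]
      exact h.stepTag_congr hG hx.1 hx.2 h.tag
  · rcases le_or_gt t M with h3 | h3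
    · obtain ⟨u, hu, ht⟩ := h.mem_lang t h1 h3
      exact ⟨u, mem_lang_cons_of_mem L hu, h.stepTag_congr hG h1 h3 ht⟩
    · have hm := hmaps t h1 h2
      obtain ⟨u, hu, ht⟩ := h.mem_lang (G t) hm.1 hm.2
      exact ⟨L :: u, h.cons_L_mem_lang_cons (sub_pos.2 h3) (hG' t h3) hm.1 hm.2 hu ht,
        hm.2.trans_lt h3, h.stepTag_congr hG hm.1 hm.2 ht⟩

theorem map_swap_map_swap (w : Word) : (w.map Letter.swap).map Letter.swap = w := by
  simp [Function.comp_def, Letter.swap_swap]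

theorem exists_model : ∀ w : Word, ∃ F m M x, Model w F m M x ∧ (w ≠ [] → m < M)
  | [] => ⟨_, _, _, _, model_nil, fun h => absurd rfl h⟩
  | L :: w => by
    obtain ⟨F, m, M, x, h, -⟩ := exists_model w
    obtain ⟨G, hG⟩ := h.cons_L
    exact ⟨G, _, _, _, hG, fun _ => by linarith [h.nonpos, h.nonneg]⟩
  | R :: w => by
    obtain ⟨F, m, M, x, h, -⟩ := exists_model w
    obtain ⟨G, hG⟩ := h.neg.cons_L
    have := hG.neg
    simp only [List.map_cons, map_swap_map_swap] at this
    exact ⟨_, _, _, _, this, fun _ => by linarith [h.nonpos, h.nonneg]⟩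

/-! ### Transport of the model to the unit interval -/

theorem StepTag.of_semiconj {X Y : Type*} [LinearOrder X] [LinearOrder Y] {f : X → X} {F : Y → Y}
    {φ : X → Y} (hφ : StrictMono φ) (h : ∀ x, φ (f x) = F (φ x)) : ∀ {w : Word} {x : X},
    StepTag F w (φ x) → StepTag f w x
  | [], x, hx => hφ.injective ((h x).trans hx)
  | c :: w, x, hx => by
    have h1 := hx.1
    have h2 := hx.2
    rw [← h] at h1 h2
    refine ⟨?_, StepTag.of_semiconj hφ h h2⟩
    cases c
    · exact hφ.lt_iff_lt.1 h1
    · exact hφ.lt_iff_lt.1 h1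

theorem exists_unitInterval_map (w : Word) : ∃ f : Icc (0 : ℝ) 1 → Icc (0 : ℝ) 1, Continuous f ∧
    (∃ x, StepTag f w x) ∧ ∀ x, ∃ u ∈ lang w, StepTag f u x := by
  by_cases hw : w = []
  · subst hw
    -- The model of the empty word is a single point and cannot be rescaled.
    exact ⟨id, continuous_id, ⟨⟨0, by simp⟩, rfl⟩, fun x => ⟨[], by simp [lang], rfl⟩⟩
  obtain ⟨F, m, M, x, h, hmM⟩ := exists_model w
  have hd : 0 < M - m := sub_pos.2 (hmM hw)
  set φ : Icc (0 : ℝ) 1 → ℝ := fun t => m + (M - m) * t with hφ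
  have hφ1 : ∀ t, m ≤ φ t ∧ φ t ≤ M := fun t =>
    ⟨by nlinarith [t.2.1], by nlinarith [t.2.2]⟩
  have hφm : StrictMono φ := fun s t hst => by
    have : (s : ℝ) < t := hst
    simp only [hφ]
    gcongr
  have hinv : ∀ y, m ≤ y → y ≤ M → (y - m) / (M - m) ∈ Icc (0 : ℝ) 1 := fun y h1 h2 =>
    ⟨div_nonneg (sub_nonneg.2 h1) hd.le, (div_le_one hd).2 (by linarith)⟩
  have hinv' : ∀ y h1 h2, φ ⟨(y - m) / (M - m), hinv y h1 h2⟩ = y := fun y h1 h2 => by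
    simp only [hφ]
    field_simp
    ring
  have hmaps := fun t => h.maps _ (hφ1 t).1 (hφ1 t).2
  set f : Icc (0 : ℝ) 1 → Icc (0 : ℝ) 1 := fun t =>
    ⟨(F (φ t) - m) / (M - m), hinv _ (hmaps t).1 (hmaps t).2⟩ with hf
  have hsc : ∀ t, φ (f t) = F (φ t) := fun t => hinv' _ (hmaps t).1 (hmaps t).2
  have hx := h.mem_Icc
  refine ⟨f, ?_, ⟨⟨_, hinv x hx.1 hx.2⟩, ?_⟩, fun t => ?_⟩
  · have := h.cont
    refine Continuous.subtype_mk ?_ _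
    fun_prop
  · refine StepTag.of_semiconj hφm hsc ?_
    rw [hinv' x hx.1 hx.2]
    exact h.tag
  · obtain ⟨u, hu, ht⟩ := h.mem_lang _ (hφ1 t).1 (hφ1 t).2
    exact ⟨u, hu, StepTag.of_semiconj hφm hsc ht⟩

/-! ### Orbit patterns and their tags -/

theorem darboux_of_ordConnected {I : Set ℝ} (hI : I.OrdConnected) {f : I → I} (hf : Continuous f) :
    Darboux f := by
  intro a b y hy
  have hconn : IsPreconnected (uIcc a b) := by
    rw [← Topology.IsInducing.subtypeVal.isPreconnected_image]
    have : ((↑) : I → ℝ) '' uIcc a b = uIcc (a : ℝ) b := by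
      ext t
      simp only [mem_image, mem_uIcc]
      constructor
      · rintro ⟨s, hs, rfl⟩
        exact hs
      · intro ht
        exact ⟨⟨t, hI.uIcc_subset a.2 b.2 (mem_uIcc.2 ht)⟩, ht, rfl⟩
    rw [this]
    exact isPreconnected_uIcc
  rcases le_total (f a) (f b) with h | h
  · rw [uIcc_of_le h] at hy
    exact hconn.intermediate_value left_mem_uIcc right_mem_uIcc hf.continuousOn hy
  · rw [uIcc_of_ge h] at hy
    exact hconn.intermediate_value right_mem_uIcc left_mem_uIcc hf.continuousOn hy

theorem compactIccSpace_of_ordConnected {I : Set ℝ} (hI : I.OrdConnected) : CompactIccSpace I := by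
  refine ⟨fun {a b} => ?_⟩
  rw [Topology.IsInducing.subtypeVal.isCompact_iff]
  have : ((↑) : I → ℝ) '' Icc a b = Icc (a : ℝ) b := by
    ext t
    constructor
    · rintro ⟨s, hs, rfl⟩
      exact hs
    · intro ht
      exact ⟨⟨t, hI.out a.2 b.2 ht⟩, ht, rfl⟩
  rw [this]
  exact isCompact_Icc

theorem PatTag.congr : ∀ {w : Word} {a b : ℕ → ℝ}, (∀ m n, a m < a n ↔ b m < b n) →
    PatTag w a → PatTag w b
  | [], a, b, hab, h => fun n => by
    have h1 := h n
    rw [le_antisymm_iff, ← not_lt, ← not_lt] at h1 ⊢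
    rwa [← hab, ← hab]
  | c :: w, a, b, hab, h => by
    refine ⟨fun n => ?_, h.2.congr fun m n => hab _ _⟩
    have h1 := h.1 n
    cases c
    · exact (hab _ _).1 h1
    · exact (hab _ _).1 h1

theorem PatTag.lt_iff_lt : ∀ {w : Word} {a b : ℕ → ℝ}, PatTag w a → PatTag w b →
    ∀ m n, a m < a n ↔ b m < b n
  | [], a, b, ha, hb, m, n => by
    have h1 : ∀ {a : ℕ → ℝ}, PatTag [] a → ∀ i, a i = a 0 := fun h i => by
      cases i with
      | zero => rfl
      | succ i => exact h i
    rw [h1 ha m, h1 ha n, h1 hb m, h1 hb n]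
    simp
  | c :: w, a, b, ha, hb, m, n => by
    match m, n with
    | 0, 0 => simp
    | m + 1, n + 1 => exact ha.2.lt_iff_lt hb.2 m n
    | 0, n + 1 =>
      have h1 := ha.1 n
      have h2 := hb.1 n
      cases c
      · exact iff_of_false (lt_asymm h1) (lt_asymm h2)
      · exact iff_of_true h1 h2
    | m + 1, 0 =>
      have h1 := ha.1 m
      have h2 := hb.1 m
      cases c
      · exact iff_of_true h1 h2
      · exact iff_of_false (lt_asymm h1) (lt_asymm h2)

theorem patTag_coe {I : Set ℝ} : ∀ {w : Word} {a : ℕ → I},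
    PatTag w (fun n => (a n : ℝ)) ↔ PatTag w a
  | [], _ => forall_congr' fun _ => Subtype.coe_inj
  | L :: _, _ => and_congr Iff.rfl patTag_coe
  | R :: _, _ => and_congr Iff.rfl patTag_coe

theorem patTag_trajectory {I : Set ℝ} {f : I → I} {x : I} {w : Word} :
    PatTag w (trajectory f x) ↔ PatTag w (orb f x) :=
  patTag_coe

theorem PatTag.exists_eq : ∀ {w : Word} {a : ℕ → ℝ}, PatTag w a → ∃ n, a (n + 1) = a n
  | [], _, h => ⟨0, h 0⟩
  | _ :: _, _, h => by
    obtain ⟨n, hn⟩ := h.2.exists_eq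
    exact ⟨n + 1, hn⟩

theorem PatTag.seqTag_eq : ∀ {w : Word} {a : ℕ → ℝ}, PatTag w a → seqTag a = w
  | [], a, h => by
    have : sInf {n : ℕ | a (n + 1) = a n} = 0 := Nat.sInf_eq_zero.2 (.inl (h 0))
    simp [seqTag, this]
  | c :: w, a, h => by
    have h0 := h.1 0
    -- The first step is nontrivial, so dropping it lowers the stopping index by exactly one.
    have hs : sInf {n : ℕ | a (n + 1) = a n} = sInf {n : ℕ | a (n + 1 + 1) = a (n + 1)} + 1 := by
      refine (Nat.sInf_add (n := 1) (p := fun n => a (n + 1) = a n) ?_).symm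
      refine le_csInf h.exists_eq fun n hn => Nat.one_le_iff_ne_zero.2 ?_
      rintro rfl
      exact h0.ne hn.symm
    have ih := h.2.seqTag_eq
    unfold seqTag at ih ⊢
    rw [hs, List.range_succ_eq_map, List.map_cons, List.map_map]
    congr 1
    cases c
    · exact if_pos h0
    · exact if_neg (lt_asymm h0)

theorem exists_patTag_of_isEF {I : Set ℝ} (hI : I.OrdConnected) {f : I → I} (hf : Continuous f)
    (hef : IsEF f) {w : Word} {x : I} (h : StepTag f w x) : PatTag w (trajectory f x) :=
  haveI := compactIccSpace_of_ordConnected hI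
  patTag_trajectory.2 (h.patTag hf (darboux_of_ordConnected hI hf) hef)

theorem EFPattern.exists_rep (α : EFPattern) :
    ∃ a : ℕ → ℝ, α.1 = Quotient.mk orderSetoid a ∧ PatTag α.tag a := by
  obtain ⟨p, I, f, x, hI, hf, hef, rfl⟩ := α
  obtain ⟨n, hn⟩ := hef x
  obtain ⟨w, hw⟩ := exists_stepTag hn
  have h := exists_patTag_of_isEF hI hf hef hw
  refine ⟨_, rfl, ?_⟩
  change PatTag (seqTag (trajectory f x)) (trajectory f x)
  rwa [h.seqTag_eq]

/-- The map `f` need not be in `EF`: `PatTag` depends only on the order pattern, and determines it.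
-/
theorem admits_iff {I : Set ℝ} {f : I → I} {α : EFPattern} :
    Admits f α ↔ ∃ x, PatTag α.tag (orb f x) := by
  obtain ⟨a, ha, hw⟩ := α.exists_rep
  refine exists_congr fun x => ?_
  rw [ha, ← patTag_trajectory]
  exact ⟨fun h => hw.congr fun m n => ((Quotient.exact h) m n).symm,
    fun h => Quotient.sound (h.lt_iff_lt hw)⟩

theorem tag_injective : Function.Injective EFPattern.tag := by
  intro α β h
  obtain ⟨a, ha, hwa⟩ := α.exists_rep
  obtain ⟨b, hb, hwb⟩ := β.exists_rep
  refine Subtype.ext ?_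
  rw [ha, hb]
  refine Quotient.sound (PatTag.lt_iff_lt hwa ?_)
  rw [h]
  exact hwb

/-- A self-map of `[0, 1]` that admits the word `w`, and only words of `lang w`. -/
theorem exists_map_admitting_lang (w : Word) : ∃ f : Icc (0 : ℝ) 1 → Icc (0 : ℝ) 1,
    Continuous f ∧ IsEF f ∧ (∃ x, PatTag w (trajectory f x)) ∧
      ∀ x u, PatTag u (trajectory f x) → u ∈ lang w := by
  obtain ⟨f, hf, ⟨x, hx⟩, h⟩ := exists_unitInterval_map w
  have hef : IsEF f := fun y => by
    obtain ⟨u, -, hu⟩ := h y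
    exact hu.exists_fixed
  refine ⟨f, hf, hef, ⟨x, exists_patTag_of_isEF ordConnected_Icc hf hef hx⟩, fun y u hu => ?_⟩
  obtain ⟨u', hu', hy⟩ := h y
  rw [← hu.seqTag_eq, (exists_patTag_of_isEF ordConnected_Icc hf hef hy).seqTag_eq]
  exact hu'

theorem tag_surjective : Function.Surjective EFPattern.tag := by
  intro w
  obtain ⟨f, hf, hef, ⟨x, hx⟩, -⟩ := exists_map_admitting_lang w
  exact ⟨⟨_, _, f, x, ordConnected_Icc, hf, hef, rfl⟩, hx.seqTag_eq⟩

theorem admitsTag_iff {I : Set ℝ} {f : I → I} {w : Word} :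
    AdmitsTag f w ↔ ∃ x, PatTag w (orb f x) := by
  constructor
  · rintro ⟨α, rfl, h⟩
    exact admits_iff.1 h
  · intro h
    obtain ⟨α, rfl⟩ := tag_surjective w
    exact ⟨α, rfl, admits_iff.2 h⟩

theorem admitsTag_tag_iff {I : Set ℝ} {f : I → I} {α : EFPattern} :
    AdmitsTag f α.tag ↔ Admits f α := by
  rw [admitsTag_iff, admits_iff]

/-! ### The equivalences for forcing -/

theorem forces_of_derivable {w u : Word} (h : Derivable w u) : Forces w u := by
  intro I hI f hf hw
  rw [admitsTag_iff] at hw ⊢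
  exact exists_patTag_of_derivable (darboux_of_ordConnected hI hf) h hw

theorem mem_lang_of_forcesOn {w u : Word} (h : ForcesOn (Icc 0 1) w u) : u ∈ lang w := by
  obtain ⟨f, hf, -, ⟨x, hx⟩, hlang⟩ := exists_map_admitting_lang w
  obtain ⟨y, hy⟩ := admitsTag_iff.1 (h f hf (admitsTag_iff.2 ⟨x, patTag_trajectory.1 hx⟩))
  exact hlang y u (patTag_trajectory.2 hy)

theorem forces_tfae (w u : Word) :
    List.TFAE [Forces w u, ForcesOn (Icc 0 1) w u, Derivable w u, u ∈ lang w] := by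
  tfae_have 1 → 2 := fun h => h _ ordConnected_Icc
  tfae_have 2 → 4 := mem_lang_of_forcesOn
  tfae_have 4 → 3 := derivable_of_mem_lang
  tfae_have 3 → 1 := forces_of_derivable
  tfae_finish

theorem patternForcesOn_iff {I : Set ℝ} {α β : EFPattern} :
    PatternForcesOn I α β ↔ ForcesOn I α.tag β.tag := by
  simp only [PatternForcesOn, ForcesOn, admitsTag_tag_iff]

theorem patternForces_iff {α β : EFPattern} : PatternForces α β ↔ Forces α.tag β.tag := by
  simp only [PatternForces, Forces, patternForcesOn_iff]

end EventuallyFixed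

theorem mainTheorem1 :
    Function.Bijective EventuallyFixed.EFPattern.tag ∧
    (∀ α β : EventuallyFixed.EFPattern,
      List.TFAE
        [EventuallyFixed.PatternForces α β,
         EventuallyFixed.PatternForcesOn (Set.Icc 0 1) α β,
         EventuallyFixed.Derivable α.tag β.tag]) ∧
    (∀ w u : EventuallyFixed.Word,
      List.TFAE
        [EventuallyFixed.Forces w u,
         EventuallyFixed.ForcesOn (Set.Icc 0 1) w u,
         EventuallyFixed.Derivable w u,
         u ∈ EventuallyFixed.lang w]) := by
  refine ⟨⟨EventuallyFixed.tag_injective, EventuallyFixed.tag_surjective⟩, fun α β => ?_,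
    EventuallyFixed.forces_tfae⟩
  rw [EventuallyFixed.patternForces_iff, EventuallyFixed.patternForcesOn_iff]
  have h := EventuallyFixed.forces_tfae α.tag β.tag
  tfae_have 1 ↔ 2 := h.out 0 1
  tfae_have 2 ↔ 3 := h.out 1 2
  tfae_finish
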